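/- Let $k$ be a field of prime characteristic $p$. Let $\mathfrak g$ be a restricted Lie algebra over $k$ with $p$-map $x\mapsto x^{[p]}$, that is, $(\lambda x)^{[p]}=\lambda^p x^{[p]}$, $\mathrm{ad}_{x^{[p]}}=(\mathrm{ad}_x)^p$ and $(x+y)^{[p]}=x^{[p]}+y^{[p]}+\sum_{i=1}^{p-1}s_i(x,y)$, where $i\,s_i(x,y)$ is the coefficient of $t^{i-1}$ in $(\mathrm{ad}_{tx+y})^{p-1}(x)$, with $t$ an indeterminate. Let $\blacktriangleright$ be a post-Lie product on $\mathfrak g$: a bilinear operation such that, for all $x,y,z\in\mathfrak g$, $$x\blacktriangleright[y,z]=[x\blacktriangleright y,z]+[y,x\blacktriangleright z],\qquad [x,y]\blacktriangleright z=a(x,y,z)-a(y,x,z),$$ where $a(x,y,z)=x\blacktriangleright(y\blacktriangleright z)-(x\blacktriangleright y)\blacktriangleright z$. Put $x^{\bullet 1}=x$, $x^{\bullet (n+1)}=x\blacktriangleright x^{\bullet n}$, $[x_1\cdots x_n]=[x_1,[x_2,\cdots[x_{n-1},x_n]]]$ (equal to $x_1$ if $n=1$), and $$x^{[p]_\blacktriangleright}=x^{[p]}+\sum_{n=1}^{p-1}\frac1n\sum_{\substack{\ell_1+\cdots+\ell_n=p\\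 \ell_i\ge1}}\frac{(p-1)!}{(\ell_1-1)!\cdots(\ell_n-1)!}\prod_{v=1}^{n-1}(\ell_1+\cdots+\ell_v)^{-1}\,[x^{\bullet\ell_1}\cdots x^{\bullet\ell_n}].$$ Assume that $(\mathfrak g,\blacktriangleright)$ is trivially restricted: for all $x,y\in\mathfrak g$, $$x^{[p]_\blacktriangleright}\blacktriangleright y=\underbrace{x\blacktriangleright(\cdots(x}_{p}\blacktriangleright y)\cdots),\qquad y\blacktriangleright x^{[p]}=(\mathrm{ad}_x)^{p-1}(y\blacktriangleright x).$$ Let $\mathfrak u(\mathfrak g)$ be the universal enveloping algebra, with its coproduct $\Delta(E)=E_{(1)}\otimes E_{(2)}$ (the algebra morphism with $\Delta(x)=x\otimes1+1\otimes x$ for $x\in\mathfrak g$), let $I$ be the two-sided ideal of $\mathfrak u(\mathfrak g)$ generated by the elements $x^p-x^{[p]}$, $x\in\mathfrak g$, and let $\pi:\mathfrak u(\mathfrak g)\to\mathfrak u_p(\mathfrak g)=\mathfrak u(\mathfrak g)/I$ be the projection onto the restricted enveloping algebra. Then: 1. There is exactly one bilinear operation $\blacktriangleright$ on $\mathfrak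 u(\mathfrak g)$ that extends the post-Lie product of $\mathfrak g$ and satisfies $1\blacktriangleright F=F$, $\;xE\blacktriangleright F=x\blacktriangleright(E\blacktriangleright F)-(x\blacktriangleright E)\blacktriangleright F$ and $E\blacktriangleright F_1F_2=(E_{(1)}\blacktriangleright F_1)(E_{(2)}\blacktriangleright F_2)$ for all $x\in\mathfrak g$ and $E,F,F_1,F_2\in\mathfrak u(\mathfrak g)$. 2. This operation preserves $I$: if $E\in I$ and $F\in\mathfrak u(\mathfrak g)$, then $E\blacktriangleright F\in I$ and $F\blacktriangleright E\in I$. 3. It descends to $\mathfrak u_p(\mathfrak g)$: there is exactly one bilinear operation $\overline{\blacktriangleright}$ on $\mathfrak u_p(\mathfrak g)$ with $\pi(E)\,\overline{\blacktriangleright}\,\pi(F)=\pi(E\blacktriangleright F)$ for all $E,F\in\mathfrak u(\mathfrak g)$. -/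

import Mathlib

open scoped TensorProduct Nat

noncomputable section

namespace RestrictedPostLie

attribute [local instance 100] LieRing.ofAssociativeRing

section Lie

variable (k : Type*) (g : Type*) [Field k] [LieRing g] [LieAlgebra k g]

/-! ### Restricted Lie algebras -/

/-- The linear map `g[t] = k[t] ⊗ g → g` taking the coefficient of `t ^ n`. -/
def coeffMap (n : ℕ) : Polynomial k ⊗[k] g →ₗ[k] g :=
  (TensorProduct.lid k g).toLinearMap ∘ₗ LinearMap.rTensor g (Polynomial.lcoeff k n)

variable {g} in
/-- Jacobson's `s_i(x, y)`: the element such that `i • s_i(x, y)` is the coefficient of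
`t ^ (i - 1)` in `(ad (t x + y)) ^ (p - 1) x`, computed in the Lie algebra `k[t] ⊗ g`
over `k[t]`, for `1 ≤ i ≤ p - 1`. -/
def jacobsonS (p i : ℕ) (x y : g) : g :=
  (i : k)⁻¹ • coeffMap k g (i - 1)
    (((LieAlgebra.ad (Polynomial k) (Polynomial k ⊗[k] g)
        ((Polynomial.X : Polynomial k) ⊗ₜ[k] x + (1 : Polynomial k) ⊗ₜ[k] y)) ^ (p - 1))
      ((1 : Polynomial k) ⊗ₜ[k] x))

/-- A restricted Lie algebra structure (a `p`-map `x ↦ x^[p]`) on the Lie algebra `g` over a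
field `k` of characteristic `p`. -/
structure PMap (p : ℕ) where
  toFun : g → g
  map_smul : ∀ (c : k) (x : g), toFun (c • x) = c ^ p • toFun x
  ad_map : ∀ x : g, LieAlgebra.ad k g (toFun x) = (LieAlgebra.ad k g x) ^ p
  map_add : ∀ x y : g,
    toFun (x + y) = toFun x + toFun y + ∑ i ∈ Finset.Icc 1 (p - 1), jacobsonS k p i x y

/-! ### Post-Lie algebras -/

/-- A post-Lie product `x ▶ y = P.op x y` on the Lie algebra `g`. -/
structure PostLieProduct where
  op : g →ₗ[k] g →ₗ[k] g
  op_lie : ∀ x y z : g, op x ⁅y, z⁆ = ⁅op x y, z⁆ + ⁅y, op x z⁆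
  lie_op : ∀ x y z : g,
    op ⁅x, y⁆ z = (op x (op y z) - op (op x y) z) - (op y (op x z) - op (op y x) z)

variable {g} in
/-- The right-nested bracket `[x₁, [x₂, … [xₙ₋₁, xₙ]]]` of a list; it is `x₁` when `n = 1`. -/
def nestedBracket : List g → g
  | [] => 0
  | [x] => x
  | x :: y :: l => ⁅x, nestedBracket (y :: l)⁆

variable {k g} {p : ℕ}

/-- `x ▶ (x ▶ ⋯ (x ▶ x))` with `n ≥ 1` occurrences of `x`. -/
def PostLieProduct.bullet (P : PostLieProduct k g) (x : g) (n : ℕ) : g :=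
  ((P.op x) ^ (n - 1)) x

/-- The sub-adjacent `p`-map: `x^[p]` plus the sum over `1 ≤ n ≤ p - 1` and over all
`(ℓ₁, …, ℓₙ)` with `ℓᵢ ≥ 1` and `ℓ₁ + ⋯ + ℓₙ = p` of
`(1 / n) * (p - 1)! / ∏ᵢ (ℓᵢ - 1)! * ∏_{1 ≤ v ≤ n - 1} (ℓ₁ + ⋯ + ℓᵥ)⁻¹`
times the nested bracket of the elements `bullet x ℓᵢ`. -/
def subadjacentPMap (R : PMap k g p) (P : PostLieProduct k g) (x : g) : g :=
  R.toFun x + ∑ n ∈ Finset.Icc 1 (p - 1), (n : k)⁻¹ •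
    ∑ c : Composition p with c.length = n,
      ((((p - 1)! : ℕ) : k) / (((c.blocks.map fun l => (l - 1)!).prod : ℕ) : k) *
          ∏ v ∈ Finset.Icc 1 (n - 1), (c.sizeUpTo v : k)⁻¹) •
        nestedBracket (c.blocks.map (P.bullet x))

/-- The post-Lie algebra `(g, P)` over the restricted Lie algebra `(g, R)` is trivially
restricted. -/
structure TriviallyRestricted (R : PMap k g p) (P : PostLieProduct k g) : Prop where
  subadjacent_op : ∀ x y : g, P.op (subadjacentPMap R P x) y = ((P.op x) ^ p) y
  op_pMap : ∀ x y : g, P.op y (R.toFun x) = ((LieAlgebra.ad k g x) ^ (p - 1)) (P.op y x)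

/-! ### Enveloping algebras -/

variable (k g) in
/-- The universal enveloping algebra of `g`. -/
abbrev U := UniversalEnvelopingAlgebra k g

variable (k) in
/-- The canonical map `g → U(g)`. -/
def incl (x : g) : U k g := UniversalEnvelopingAlgebra.ι k x

variable (k g) in
/-- The Lie algebra morphism `g → U(g) ⊗ U(g)`, `x ↦ x ⊗ 1 + 1 ⊗ x`. -/
def primitiveHom : g →ₗ⁅k⁆ U k g ⊗[k] U k g where
  toFun x := incl k x ⊗ₜ[k] 1 + 1 ⊗ₜ[k] incl k x
  map_add' x y := by
    simp only [incl, map_add, TensorProduct.add_tmul, TensorProduct.tmul_add]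
    abel
  map_smul' c x := by
    simp only [incl, map_smul, RingHom.id_apply, smul_add, TensorProduct.smul_tmul',
      TensorProduct.tmul_smul]
  map_lie' {x y} := by
    simp only [incl, LieHom.map_lie, LieRing.of_associative_ring_bracket,
      TensorProduct.sub_tmul, TensorProduct.tmul_sub, mul_add, add_mul,
      Algebra.TensorProduct.tmul_mul_tmul, one_mul, mul_one]
    abel

variable (k g) in
/-- The coproduct of `U(g)`: the algebra morphism with `Δ x = x ⊗ 1 + 1 ⊗ x` for `x` in `g`. -/
def coproduct : U k g →ₐ[k] U k g ⊗[k] U k g :=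
  UniversalEnvelopingAlgebra.lift k (primitiveHom k g)

/-- The bilinear operation `T E F = E ▶ F` on `U(g)` is the extension of the post-Lie product:
it restricts to it on `g` and satisfies
`1 ▶ F = F`, `(x E) ▶ F = x ▶ (E ▶ F) - (x ▶ E) ▶ F` for `x` in `g`, and
`E ▶ (F₁ F₂) = (E₍₁₎ ▶ F₁) (E₍₂₎ ▶ F₂)` in Sweedler notation. -/
structure IsEnvelopeExtension (P : PostLieProduct k g)
    (T : U k g →ₗ[k] U k g →ₗ[k] U k g) : Prop where
  incl_incl : ∀ x y : g, T (incl k x) (incl k y) = incl k (P.op x y)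
  one_left : ∀ F : U k g, T 1 F = F
  incl_mul : ∀ (x : g) (E F : U k g),
    T (incl k x * E) F = T (incl k x) (T E F) - T (T (incl k x) E) F
  right_mul : ∀ E F₁ F₂ : U k g,
    T E (F₁ * F₂) =
      LinearMap.mul' k (U k g) (TensorProduct.map (T.flip F₁) (T.flip F₂) (coproduct k g E))

/-- The two-sided ideal of `U(g)` generated by the elements `x ^ p - x^[p]`, `x` in `g`. -/
def restrictedIdeal (R : PMap k g p) : TwoSidedIdeal (U k g) :=
  TwoSidedIdeal.span (Set.range fun x : g => incl k x ^ p - incl k (R.toFun x))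

/-- The restricted enveloping algebra `u_p(g)`, the quotient of `U(g)` by `restrictedIdeal`. -/
abbrev RestrictedEnvelope (R : PMap k g p) := (restrictedIdeal R).ringCon.Quotient

/-- The canonical projection `U(g) → u_p(g)`. -/
def proj (R : PMap k g p) : U k g →ₐ[k] RestrictedEnvelope R :=
  RingCon.mkₐ k (restrictedIdeal R).ringCon

end Lie

end RestrictedPostLie

end

/-!
The sub-adjacent Lie algebra `ḡ` is `g` with the bracket `x ▶ y - y ▶ x + ⁅x, y⁆`. It acts on `U(g)`
by the derivations `D_x` that extend `x ▶ ·`, and also by `L_x + D_x`, where `L_x` is left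
multiplication. Acting by the latter on `1` gives the isomorphism `U(ḡ) ≅ U(g)` of Oudom and Guin;
transporting along it the action of `U(ḡ)` by derivations gives the product `▶` on `U(g)`. Hence
`T E = E ▶ ·` satisfies `T (x E + D_x E) = D_x ∘ T E`, a recursion that determines it.

In particular `T ((L_x + D_x) ^ p 1) = D_x ^ p`. Jacobson's formula for `(L_x + D_x) ^ p`, with its
nested commutators expanded by the Leibniz rule, gives
`(L_x + D_x) ^ p 1 = x ^ p - x^[p] + x^[p]_▶`, while `D_x ^ p` is the derivation that extends
`x^[p]_▶ ▶ ·` because `g` is trivially restricted. Therefore `T (x ^ p - x^[p]) = 0`. Moreover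
`x ^ p - x^[p]` is central and killed by every `D_y`, so `T` vanishes on the ideal these elements
generate and every `T F` preserves it.
-/

noncomputable section

namespace RestrictedPostLie

attribute [local instance 100] LieRing.ofAssociativeRing

open Finset.HasAntidiagonal (antidiagonal mem_antidiagonal)
open LieAlgebra (ad)
open LinearMap (mulLeft mulRight)
open UniversalEnvelopingAlgebra (ι lift lift_ι_apply)

/-! ### Derivations of associative algebras in characteristic `p` -/

section Leibniz

variable {k A : Type*} [CommRing k] [Ring A] [Algebra k A]

/-- The Leibniz rule for a linear endomorphism of a possibly noncommutative algebra; Mathlib's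
`Derivation` requires the algebra to be commutative. -/
def IsLeibniz (d : Module.End k A) : Prop :=
  ∀ a b, d (a * b) = d a * b + a * d b

theorem isLeibniz_iff_lie_mulLeft {d : Module.End k A} :
    IsLeibniz d ↔ ∀ a, ⁅d, mulLeft k a⁆ = mulLeft k (d a) := by
  simp only [IsLeibniz, LinearMap.ext_iff, LieRing.of_associative_ring_bracket,
    LinearMap.sub_apply, Module.End.mul_apply, LinearMap.mulLeft_apply]
  exact forall₂_congr fun a b => sub_eq_iff_eq_add.symm

theorem isLeibniz_ad (a : A) : IsLeibniz (ad k A a) := fun b c => by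
  simp only [LieAlgebra.ad_apply, LieRing.of_associative_ring_bracket]
  noncomm_ring

namespace IsLeibniz

variable {d e : Module.End k A}

theorem map_one (hd : IsLeibniz d) : d 1 = 0 := by
  simpa using hd 1 1

theorem add (hd : IsLeibniz d) (he : IsLeibniz e) : IsLeibniz (d + e) := fun a b => by
  simp only [LinearMap.add_apply, hd a b, he a b]
  noncomm_ring

theorem smul (c : k) (hd : IsLeibniz d) : IsLeibniz (c • d) := fun a b => by
  simp only [LinearMap.smul_apply, hd a b, smul_add, smul_mul_assoc, mul_smul_comm]

theorem lie (hd : IsLeibniz d) (he : IsLeibniz e) : IsLeibniz ⁅d, e⁆ := fun a b => by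
  simp only [LieRing.of_associative_ring_bracket, LinearMap.sub_apply, Module.End.mul_apply,
    hd _ _, he _ _, map_add]
  noncomm_ring

theorem ad_pow_mulLeft (hd : IsLeibniz d) (a : A) (n : ℕ) :
    (ad k (Module.End k A) d ^ n) (mulLeft k a) = mulLeft k ((d ^ n) a) := by
  induction n with
  | zero => rfl
  | succ n ih =>
    rw [pow_succ', Module.End.mul_apply, ih, LieAlgebra.ad_apply,
      isLeibniz_iff_lie_mulLeft.1 hd, pow_succ', Module.End.mul_apply]

end IsLeibniz

end Leibniz

theorem map_ad_pow {k L L' : Type*} [CommRing k] [LieRing L] [LieAlgebra k L] [LieRing L']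
    [LieAlgebra k L'] (f : L →ₗ⁅k⁆ L') (x y : L) (n : ℕ) :
    f ((ad k L x ^ n) y) = (ad k L' (f x) ^ n) (f y) := by
  induction n with
  | zero => rfl
  | succ n ih =>
    simp only [pow_succ', Module.End.mul_apply, LieAlgebra.ad_apply, LieHom.map_lie, ih]

section CharP

variable {k A : Type*} [CommRing k] [Ring A] [Algebra k A] (p : ℕ) [hp : Fact p.Prime] [CharP k p]

theorem ad_pow_char (a : A) : ad k A a ^ p = ad k A (a ^ p) := by
  nontriviality A
  have : CharP (Module.End k A) p := (CharP.charP_iff_prime_eq_zero hp.out).2 <| by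
    rw [← map_natCast (algebraMap k (Module.End k A)), CharP.cast_eq_zero, map_zero]
  simp only [LieAlgebra.ad_eq_lmul_left_sub_lmul_right, Pi.sub_apply]
  rw [sub_pow_char_of_commute p (LinearMap.commute_mulLeft_right a a),
    LinearMap.pow_mulLeft, LinearMap.pow_mulRight]

namespace IsLeibniz

variable {d : Module.End k A}

theorem pow_char (hd : IsLeibniz d) : IsLeibniz (d ^ p) :=
  isLeibniz_iff_lie_mulLeft.2 fun a => by
    rw [← LieAlgebra.ad_apply k, ← ad_pow_char, hd.ad_pow_mulLeft]

-- Evaluate `(ad a) ^ p = ad (a ^ p)` for the operator `L_a` of left multiplication on `d`.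
theorem map_pow_char (hd : IsLeibniz d) (a : A) : d (a ^ p) = (ad k A a ^ (p - 1)) (d a) := by
  have key : mulLeft k (d (a ^ p)) = mulLeft k ((ad k A a ^ (p - 1)) (d a)) := calc
    _ = -(ad k _ (mulLeft k a) ^ p) d := by
      rw [ad_pow_char, LinearMap.pow_mulLeft, LieAlgebra.ad_apply, lie_skew,
        isLeibniz_iff_lie_mulLeft.1 hd]
    _ = (ad k _ (mulLeft k a) ^ (p - 1)) (mulLeft k (d a)) := by
      rw [← Nat.sub_add_cancel hp.out.one_le, pow_succ, Nat.add_sub_cancel,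
        Module.End.mul_apply, ← map_neg, LieAlgebra.ad_apply, lie_skew,
        isLeibniz_iff_lie_mulLeft.1 hd]
    _ = _ := (map_ad_pow (Algebra.lmul k A).toLieHom a (d a) (p - 1)).symm
  simpa using LinearMap.congr_fun key 1

end IsLeibniz

end CharP

/-! ### Powers of Leibniz operators as sums over compositions -/

theorem pow_bilinear_apply {k M N Q : Type*} [CommSemiring k] [AddCommMonoid M] [AddCommMonoid N]
    [AddCommMonoid Q] [Module k M] [Module k N] [Module k Q] (β : M →ₗ[k] N →ₗ[k] Q)
    {S : Module.End k M} {d : Module.End k N} {T : Module.End k Q}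
    (hT : ∀ u v, T (β u v) = β (S u) v + β u (d v)) (m : ℕ) (u : M) (v : N) :
    (T ^ m) (β u v) = ∑ ij ∈ antidiagonal m, m.choose ij.1 • β ((S ^ ij.1) u) ((d ^ ij.2) v) := by
  induction m with
  | zero => simp
  | succ m ih =>
    rw [Finset.sum_antidiagonal_choose_succ_nsmul (fun i j => β ((S ^ i) u) ((d ^ j) v)),
      pow_succ', Module.End.mul_apply, ih, map_sum, ← Finset.sum_add_distrib]
    refine Finset.sum_congr rfl fun ij hij => ?_
    rw [Nat.choose_symm_of_eq_add (mem_antidiagonal.1 hij).symm, map_nsmul, hT,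
      ← smul_add, pow_succ', pow_succ', Module.End.mul_apply, Module.End.mul_apply, add_comm]

theorem sum_composition_succ {M : Type*} [AddCommMonoid M] (f : List ℕ → M) (m : ℕ) :
    ∑ c : Composition (m + 1), f c.blocks =
      ∑ ij ∈ antidiagonal m, ∑ c : Composition ij.1, f (c.blocks ++ [ij.2 + 1]) := by
  rw [Finset.sum_sigma']
  symm
  refine Finset.sum_bij (fun a ha => ⟨a.2.blocks ++ [a.1.2 + 1], ?_, ?_⟩)
    (fun _ _ => Finset.mem_univ _) ?_ ?_ fun _ _ => rfl
  · intro i hi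
    rcases List.mem_append.1 hi with hi | hi
    · exact a.2.blocks_pos hi
    · exact List.mem_singleton.1 hi ▸ Nat.succ_pos _
  · have := mem_antidiagonal.1 (Finset.mem_sigma.1 ha).1
    simp only [List.sum_append, a.2.blocks_sum, List.sum_singleton]
    lia
  · rintro ⟨⟨i, j⟩, c⟩ _ ⟨⟨i', j'⟩, c'⟩ _ h
    obtain ⟨hblocks, hlast⟩ : c.blocks = c'.blocks ∧ [j + 1] = [j' + 1] :=
      List.append_inj' (congrArg Composition.blocks h) rfl
    obtain rfl : i = i' :=
      c.blocks_sum.symm.trans ((congrArg List.sum hblocks).trans c'.blocks_sum)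
    obtain rfl : j = j' := by simpa using hlast
    obtain rfl : c = c' := Composition.ext hblocks
    rfl
  · intro c _
    have hne : c.blocks ≠ [] := fun h => by simpa [h] using c.blocks_sum
    have hsplit := List.dropLast_append_getLast hne
    have hpos : 0 < c.blocks.getLast hne := c.blocks_pos (List.getLast_mem hne)
    have hsum : c.blocks.dropLast.sum + c.blocks.getLast hne = m + 1 := by
      simpa only [List.sum_append, List.sum_singleton, c.blocks_sum] using congrArg List.sum hsplit
    refine ⟨⟨⟨c.blocks.dropLast.sum, c.blocks.getLast hne - 1⟩,
      ⟨c.blocks.dropLast, fun hi => c.blocks_pos (List.mem_of_mem_dropLast hi), rfl⟩⟩, ?_, ?_⟩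
    · simp only [Finset.mem_sigma, mem_antidiagonal, Finset.mem_univ, and_true]
      lia
    · ext1
      simp only [Nat.sub_add_cancel hpos, hsplit]

section Weights

variable (k : Type*) [Field k]

/-- The weight `∏ᵢ ((ℓᵢ - 1)!)⁻¹ * ∏_{1 ≤ v ≤ n} (ℓ₁ + ⋯ + ℓᵥ)⁻¹` of the list `(ℓ₁, …, ℓₙ)`: up to
the factor `m!`, its coefficient in the `m`-th noncommutative Bell polynomial. -/
def blockWeight (l : List ℕ) : k :=
  (((l.map fun i => (i - 1)!).prod : ℕ) : k)⁻¹ *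
    ∏ v ∈ Finset.Icc 1 l.length, ((l.take v).sum : k)⁻¹

/-- The coefficient of the nested bracket of `(ℓ₁, …, ℓₙ)` in the sub-adjacent `p`-map. In contrast
to `blockWeight`, the total sum `ℓ₁ + ⋯ + ℓₙ` is not inverted. -/
def bracketCoeff (p : ℕ) (l : List ℕ) : k :=
  (((p - 1)! : ℕ) : k) / (((l.map fun i => (i - 1)!).prod : ℕ) : k) *
    ∏ v ∈ Finset.Icc 1 (l.length - 1), ((l.take v).sum : k)⁻¹

theorem prod_sum_take_append_singleton (l : List ℕ) (i : ℕ) :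
    ∏ v ∈ Finset.Icc 1 l.length, (((l ++ [i]).take v).sum : k)⁻¹ =
      ∏ v ∈ Finset.Icc 1 l.length, ((l.take v).sum : k)⁻¹ :=
  Finset.prod_congr rfl fun v hv => by
    rw [List.take_append_of_le_length (Finset.mem_Icc.1 hv).2]

theorem blockWeight_append_succ (l : List ℕ) (j : ℕ) :
    blockWeight k (l ++ [j + 1]) =
      ((l.sum + j + 1 : ℕ) : k)⁻¹ * (j ! : k)⁻¹ * blockWeight k l := by
  rw [blockWeight, blockWeight, List.length_append, List.length_singleton,
    Finset.prod_Icc_succ_top (by lia), prod_sum_take_append_singleton,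
    List.take_of_length_le (by simp)]
  simp only [List.map_append, List.map_cons, List.map_nil, List.prod_append, List.prod_singleton,
    Nat.add_sub_cancel, List.sum_append, List.sum_singleton, Nat.cast_mul, mul_inv, add_assoc]
  ring

theorem bracketCoeff_append_succ (p : ℕ) (l : List ℕ) (j : ℕ) :
    bracketCoeff k p (l ++ [j + 1]) = ((p - 1)! : k) * (j ! : k)⁻¹ * blockWeight k l := by
  rw [bracketCoeff, blockWeight, List.length_append, List.length_singleton, Nat.add_sub_cancel,
    prod_sum_take_append_singleton]
  simp only [List.map_append, List.map_cons, List.map_nil, List.prod_append, List.prod_singleton,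
    Nat.add_sub_cancel, Nat.cast_mul, div_eq_mul_inv, mul_inv]
  ring

variable {k}

theorem cast_factorial_ne_zero_of_le {i m : ℕ} (hi : i ≤ m) (hm : (m ! : k) ≠ 0) :
    (i ! : k) ≠ 0 := by
  obtain ⟨c, hc⟩ := Nat.factorial_dvd_factorial hi
  rw [hc, Nat.cast_mul] at hm
  exact left_ne_zero_of_mul hm

theorem cast_choose_mul_factorial {m i j : ℕ} (hm : (m ! : k) ≠ 0) (h : i + j = m) :
    (m.choose i : k) * (i ! : k) = (m ! : k) * (j ! : k)⁻¹ := by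
  have hj := cast_factorial_ne_zero_of_le (by lia : j ≤ m) hm
  rw [eq_mul_inv_iff_mul_eq₀ hj, ← Nat.choose_mul_factorial_mul_factorial (by lia : i ≤ m),
    show m - i = j by lia, Nat.cast_mul, Nat.cast_mul]

end Weights

section NestedBracket

variable {k L : Type*} [CommRing k] [LieRing L] [LieAlgebra k L]

theorem nestedBracket_cons (x : L) {l : List L} (h : l ≠ []) :
    nestedBracket (x :: l) = ⁅x, nestedBracket l⁆ := by
  obtain ⟨y, l, rfl⟩ := List.exists_cons_of_ne_nil h
  rw [nestedBracket]

theorem nestedBracket_append_singleton (l : List L) (a : L) :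
    nestedBracket (l ++ [a]) = (l.map (ad k L)).prod a := by
  induction l with
  | nil => simp [nestedBracket]
  | cons x l ih =>
    rw [List.cons_append, nestedBracket_cons _ (by simp), ih, List.map_cons, List.prod_cons,
      Module.End.mul_apply, LieAlgebra.ad_apply]

theorem map_nestedBracket {L' : Type*} [LieRing L'] [LieAlgebra k L'] (f : L →ₗ⁅k⁆ L')
    (l : List L) : f (nestedBracket l) = nestedBracket (l.map f) := by
  induction l with
  | nil => simp [nestedBracket]
  | cons x l ih =>
    obtain rfl | hl := eq_or_ne l []
    · simp [nestedBracket]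
    · rw [nestedBracket_cons x hl, LieHom.map_lie, ih, List.map_cons,
        nestedBracket_cons _ (by simpa using hl)]

end NestedBracket

section Compositions

variable {k A L : Type*} [Field k] [Ring A] [Algebra k A] [LieRing L] [LieAlgebra k L]

theorem pow_apply_one_eq_sum_composition {S d : Module.End k A}
    (hS : ∀ a b, S (a * b) = S a * b + a * d b) {m : ℕ} (hm : (m ! : k) ≠ 0) :
    (S ^ m) 1 = ∑ c : Composition m, ((m ! : k) * blockWeight k c.blocks) •
      (c.blocks.map fun l => (d ^ (l - 1)) (S 1)).prod := by
  induction m using Nat.strong_induction_on with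
  | _ m ih =>
    obtain _ | m := m
    · simp [blockWeight, (Composition.blocks_eq_nil _).2 rfl, composition_card]
    have hpow := pow_bilinear_apply (LinearMap.mul k A) hS m 1 (S 1)
    simp only [LinearMap.mul_apply', one_mul] at hpow
    rw [pow_succ, Module.End.mul_apply, hpow, sum_composition_succ fun l =>
      (((m + 1)! : k) * blockWeight k l) • (l.map fun l => (d ^ (l - 1)) (S 1)).prod]
    refine Finset.sum_congr rfl fun ij hij => ?_
    rw [mem_antidiagonal] at hij
    rw [ih ij.1 (by lia) (cast_factorial_ne_zero_of_le (by lia) hm), Finset.sum_mul,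
      Finset.smul_sum]
    refine Finset.sum_congr rfl fun c _ => ?_
    have hm' := cast_factorial_ne_zero_of_le m.le_succ hm
    have hm1 : ((m + 1 : ℕ) : k) ≠ 0 := by
      rw [Nat.factorial_succ, Nat.cast_mul] at hm
      exact left_ne_zero_of_mul hm
    rw [blockWeight_append_succ, c.blocks_sum, hij, List.map_append, List.prod_append,
      List.map_singleton, List.prod_singleton, Nat.add_sub_cancel, smul_mul_assoc,
      ← Nat.cast_smul_eq_nsmul k, smul_smul, ← mul_assoc, cast_choose_mul_factorial hm' hij,
      Nat.factorial_succ, Nat.cast_mul]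
    field_simp

-- Evaluation of endomorphisms of `L` on `L` is a bilinear map for which `ad (ξ + D)` satisfies a
-- Leibniz rule, with `u ↦ (ad ξ) u + [ad D, u]` acting on the first argument.
theorem ad_add_pow_apply_left (ξ D : L) {m : ℕ} (hm : (m ! : k) ≠ 0) :
    (ad k L (ξ + D) ^ m) ξ = ∑ c : Composition (m + 1), bracketCoeff k (m + 1) c.blocks •
      nestedBracket (c.blocks.map fun l => (ad k L D ^ (l - 1)) ξ) := by
  let d : Module.End k (Module.End k L) := ad k _ (ad k L D)
  let S : Module.End k (Module.End k L) := mulLeft k (ad k L ξ) + d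
  have hS (u v : Module.End k L) : S (u * v) = S u * v + u * d v := by
    simp only [S, d, LinearMap.add_apply, LinearMap.mulLeft_apply, isLeibniz_ad _ u v]
    noncomm_ring
  have hS1 : S 1 = ad k L ξ := by simp [S, d, (isLeibniz_ad (k := k) (ad k L D)).map_one]
  have hT (u : Module.End k L) (x : L) : ad k L (ξ + D) (u x) = S u x + u (ad k L D x) := by
    simp only [S, d, LinearMap.add_apply, LinearMap.mulLeft_apply, LieAlgebra.ad_apply,
      LieRing.of_associative_ring_bracket, LinearMap.sub_apply, Module.End.mul_apply, add_lie]
    abel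
  have hpow := pow_bilinear_apply (S := S) (LinearMap.id : Module.End k L →ₗ[k] L →ₗ[k] L) hT m 1 ξ
  simp only [LinearMap.id_apply, Module.End.one_apply] at hpow
  rw [hpow, sum_composition_succ fun l => bracketCoeff k (m + 1) l •
    nestedBracket (l.map fun l => (ad k L D ^ (l - 1)) ξ)]
  refine Finset.sum_congr rfl fun ij hij => ?_
  rw [mem_antidiagonal] at hij
  rw [pow_apply_one_eq_sum_composition hS (cast_factorial_ne_zero_of_le (by lia) hm),
    LinearMap.sum_apply, Finset.smul_sum]
  refine Finset.sum_congr rfl fun c _ => ?_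
  rw [hS1, bracketCoeff_append_succ, List.map_append, List.map_singleton, Nat.add_sub_cancel,
    nestedBracket_append_singleton (k := k), List.map_map, Nat.add_sub_cancel,
    ← cast_choose_mul_factorial hm hij, LinearMap.smul_apply, ← Nat.cast_smul_eq_nsmul k,
    smul_smul, mul_assoc]
  simp only [d, Function.comp_def, map_ad_pow (ad k L) D ξ]

end Compositions

/-! ### The `p`-th power of a sum -/

section AddPow

open Polynomial

variable {k A : Type*} [Ring A]

theorem lie_monomial_monomial (m n : ℕ) (a b : A) :
    ⁅monomial m a, monomial n b⁆ = monomial (m + n) ⁅a, b⁆ := by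
  simp only [LieRing.of_associative_ring_bracket, monomial_mul_monomial, map_sub, add_comm n m]

theorem nestedBracket_map_monomial_one (l : List A) :
    nestedBracket (l.map (monomial 1)) = monomial l.length (nestedBracket l) := by
  induction l with
  | nil => simp [nestedBracket]
  | cons a l ih =>
    obtain rfl | hl := eq_or_ne l []
    · simp [nestedBracket]
    · rw [List.map_cons, nestedBracket_cons _ (by simpa using hl), ih, nestedBracket_cons a hl,
        lie_monomial_monomial, List.length_cons, add_comm]

section CommRing

variable [CommRing k] [Algebra k A]

theorem ad_C_pow_monomial (a b : A) (m n : ℕ) :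
    (ad k A[X] (C a) ^ n) (monomial m b) = monomial m ((ad k A a ^ n) b) := by
  induction n with
  | zero => rfl
  | succ n ih =>
    rw [pow_succ', Module.End.mul_apply, ih, LieAlgebra.ad_apply, ← monomial_zero_left,
      lie_monomial_monomial, zero_add, pow_succ', Module.End.mul_apply, LieAlgebra.ad_apply]

variable (k A) in
/-- The Euler operator `X * d/dX`, which multiplies the coefficient of `X ^ n` by `n`. -/
def eulerOperator : Module.End k A[X] :=
  mulLeft k X * (derivative (R := A)).restrictScalars k

theorem isLeibniz_eulerOperator : IsLeibniz (eulerOperator k A) := fun f g => by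
  change X * derivative (f * g) = X * derivative f * g + f * (X * derivative g)
  rw [derivative_mul, mul_add, ← mul_assoc, ← mul_assoc, ← mul_assoc, X_mul (p := f)]

theorem coeff_eulerOperator (f : A[X]) (n : ℕ) :
    (eulerOperator k A f).coeff n = (n : k) • f.coeff n := by
  change (X * derivative f).coeff n = _
  cases n with
  | zero => simp
  | succ n =>
    rw [coeff_X_mul, coeff_derivative, Nat.cast_smul_eq_nsmul, nsmul_eq_mul', Nat.cast_succ]

theorem eulerOperator_monomial_one_add_C (ξ D : A) :
    eulerOperator k A (monomial 1 ξ + C D) = monomial 1 ξ := by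
  change X * derivative (monomial 1 ξ + C D) = _
  simp [X_mul, C_mul_X_eq_monomial]

end CommRing

variable [Field k] [Algebra k A] (p : ℕ) [hp : Fact p.Prime] [CharP k p]

theorem smul_coeff_monomial_one_add_C_pow_char (ξ D : A) (n : ℕ) :
    (n : k) • ((monomial 1 ξ + C D) ^ p).coeff n =
      ∑ c : Composition p with c.length = n, bracketCoeff k p c.blocks •
        nestedBracket (c.blocks.map fun l => (ad k A D ^ (l - 1)) ξ) := by
  have hp1 : p - 1 + 1 = p := Nat.sub_add_cancel hp.out.one_le
  have hfac : ((p - 1)! : k) ≠ 0 := by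
    rw [Ne, CharP.cast_eq_zero_iff k p, hp.out.dvd_factorial]
    lia
  have hpow := ad_add_pow_apply_left (k := k) (monomial 1 ξ : A[X]) (C D) hfac
  rw [hp1] at hpow
  rw [← coeff_eulerOperator, isLeibniz_eulerOperator.map_pow_char p,
    eulerOperator_monomial_one_add_C, hpow, finsetSum_coeff, Finset.sum_filter]
  refine Finset.sum_congr rfl fun c _ => ?_
  have hmap : c.blocks.map (fun l => (ad k A[X] (C D) ^ (l - 1)) (monomial 1 ξ)) =
      (c.blocks.map fun l => (ad k A D ^ (l - 1)) ξ).map (monomial 1) := by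
    simp only [List.map_map, Function.comp_def, ad_C_pow_monomial]
  rw [hmap, nestedBracket_map_monomial_one, List.length_map, coeff_smul, coeff_monomial, smul_ite,
    smul_zero]

theorem add_pow_char_eq_sum_composition (ξ D : A) :
    (ξ + D) ^ p = ξ ^ p + D ^ p + ∑ n ∈ Finset.Icc 1 (p - 1), (n : k)⁻¹ •
      ∑ c : Composition p with c.length = n, bracketCoeff k p c.blocks •
        nestedBracket (c.blocks.map fun l => (ad k A D ^ (l - 1)) ξ) := by
  let f : A[X] := monomial 1 ξ + C D
  have hdeg : f.natDegree ≤ 1 := natDegree_add_le_of_degree_le (natDegree_monomial_le ξ) (by simp)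
  have hdegp : (f ^ p).natDegree < p + 1 :=
    (natDegree_pow_le_of_le p hdeg).trans_lt (by simp)
  have htop : (f ^ p).coeff p = ξ ^ p := by
    simpa [f] using coeff_pow_of_natDegree_le (m := p) hdeg
  have hbot : (f ^ p).coeff 0 = D ^ p := by
    rw [← constantCoeff_apply, map_pow]
    simp [f]
  have hmid (n : ℕ) (hn : n ∈ Finset.Icc 1 (p - 1)) :
      (f ^ p).coeff n = (n : k)⁻¹ • ∑ c : Composition p with c.length = n,
        bracketCoeff k p c.blocks •
          nestedBracket (c.blocks.map fun l => (ad k A D ^ (l - 1)) ξ) := by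
    rw [Finset.mem_Icc] at hn
    have hn0 : (n : k) ≠ 0 := by
      rw [Ne, CharP.cast_eq_zero_iff k p]
      exact Nat.not_dvd_of_pos_of_lt (by lia) (by lia)
    rw [← smul_coeff_monomial_one_add_C_pow_char p, inv_smul_smul₀ hn0]
  let evalOne : A[X] →+* A := eval₂RingHom' (RingHom.id A) 1 fun a => Commute.one_right a
  calc
    (ξ + D) ^ p = evalOne (f ^ p) := by
      rw [map_pow]
      simp [evalOne, f, eval₂RingHom']
    _ = ∑ n ∈ Finset.range (p + 1), (f ^ p).coeff n :=
      (eval₂_eq_sum_range' (RingHom.id A) hdegp 1).trans (by simp)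
    _ = _ := by
      rw [Finset.sum_range_succ, htop, Finset.range_eq_Ico,
        Finset.sum_eq_sum_Ico_succ_bot hp.out.pos, hbot, ← Finset.sum_congr rfl hmid,
        show Finset.Ico (0 + 1) p = Finset.Icc 1 (p - 1) by ext; simp; lia]
      abel

end AddPow

variable {k g : Type*} [Field k] [LieRing g] [LieAlgebra k g]

/-! ### Universal enveloping algebras -/

section Enveloping

theorem incl_add (x y : g) : incl k (x + y) = incl k x + incl k y := map_add (ι k) x y

theorem incl_sub (x y : g) : incl k (x - y) = incl k x - incl k y := map_sub (ι k) x y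

theorem incl_smul (c : k) (x : g) : incl k (c • x) = c • incl k x := map_smul (ι k) c x

theorem incl_lie (x y : g) : incl k ⁅x, y⁆ = incl k x * incl k y - incl k y * incl k x :=
  LieHom.map_lie (ι k) x y

theorem lift_incl {A : Type*} [Ring A] [Algebra k A] (f : g →ₗ⁅k⁆ A) (x : g) :
    lift k f (incl k x) = f x :=
  lift_ι_apply k f x

theorem lift_incl_mul_apply {M : Type*} [AddCommGroup M] [Module k M]
    (f : g →ₗ⁅k⁆ Module.End k M) (x : g) (E : U k g) (m : M) :
    lift k f (incl k x * E) m = f x (lift k f E m) := by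
  rw [map_mul, lift_incl, Module.End.mul_apply]

theorem adjoin_range_incl : Algebra.adjoin k (Set.range (incl k : g → U k g)) = ⊤ := by
  set W := Algebra.adjoin k (Set.range (incl k : g → U k g))
  let f : g →ₗ⁅k⁆ W :=
    { toFun := fun x => ⟨incl k x, Algebra.subset_adjoin ⟨x, rfl⟩⟩
      map_add' := fun x y => Subtype.ext (incl_add x y)
      map_smul' := fun c x => Subtype.ext (incl_smul c x)
      map_lie' := fun {x y} => Subtype.ext (incl_lie x y) }
  have hf : W.val.comp (lift k f) = AlgHom.id k (U k g) := by
    ext x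
    exact congrArg Subtype.val (lift_incl f x)
  refine Algebra.eq_top_iff.2 fun E => ?_
  rw [← AlgHom.id_apply (R := k) E, ← hf]
  exact (lift k f E).2

theorem envelope_induction {K : Submodule k (U k g)} (one : 1 ∈ K)
    (incl_mul : ∀ x : g, ∀ E ∈ K, incl k x * E ∈ K) (E : U k g) : E ∈ K := by
  suffices ∀ F ∈ K, E * F ∈ K by simpa using this 1 one
  have hE : E ∈ Algebra.adjoin k (Set.range (incl k : g → U k g)) :=
    adjoin_range_incl (k := k) (g := g) ▸ Algebra.mem_top
  induction hE using Algebra.adjoin_induction with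
  | mem _ hx =>
    obtain ⟨x, rfl⟩ := hx
    exact incl_mul x
  | algebraMap c => exact fun F hF => by simpa [← Algebra.smul_def] using K.smul_mem c hF
  | add E E' _ _ ihE ihE' =>
    exact fun F hF => by simpa [add_mul] using K.add_mem (ihE F hF) (ihE' F hF)
  | mul E E' _ _ ihE ihE' => exact fun F hF => by simpa [mul_assoc] using ihE _ (ihE' F hF)

theorem commute_of_commute_incl {z : U k g} (hz : ∀ x : g, Commute z (incl k x)) (E : U k g) :
    Commute z E := by
  have hE : E ∈ Algebra.adjoin k (Set.range (incl k : g → U k g)) :=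
    adjoin_range_incl (k := k) (g := g) ▸ Algebra.mem_top
  induction hE using Algebra.adjoin_induction with
  | mem _ hx =>
    obtain ⟨x, rfl⟩ := hx
    exact hz x
  | algebraMap c => exact Algebra.commute_algebraMap_right c z
  | add E E' _ _ ihE ihE' => exact ihE.add_right ihE'
  | mul E E' _ _ ihE ihE' => exact ihE.mul_right ihE'

theorem IsLeibniz.ext_incl {d e : Module.End k (U k g)} (hd : IsLeibniz d) (he : IsLeibniz e)
    (h : ∀ x : g, d (incl k x) = e (incl k x)) : d = e := by
  ext E
  refine envelope_induction (K := LinearMap.eqLocus d e) ?_ (fun x F hF => ?_) E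
  · rw [LinearMap.mem_eqLocus, hd.map_one, he.map_one]
  · rw [LinearMap.mem_eqLocus] at hF ⊢
    rw [hd, he, hF, h]

/-- The Lie algebra morphism `x ↦ x + ε d x` from `g` to the dual numbers over `U(g)`, for `d` a
derivation of `g`. The coefficient of `ε` in its extension to `U(g)` is the derivation of `U(g)`
that extends `d`. -/
def dualNumberHom (d : LieDerivation k g g) : g →ₗ⁅k⁆ TrivSqZeroExt (U k g) (U k g) where
  toFun x := TrivSqZeroExt.inl (incl k x) + TrivSqZeroExt.inr (incl k (d x))
  map_add' x y := by ext <;> simp [incl_add]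
  map_smul' c x := by ext <;> simp [incl_smul]
  map_lie' {x y} := by
    ext
    · simp [incl_lie, LieRing.of_associative_ring_bracket]
    · simp only [incl_lie, incl_sub, LieDerivation.apply_lie_eq_sub,
        LieRing.of_associative_ring_bracket, TrivSqZeroExt.snd_add, TrivSqZeroExt.snd_sub,
        TrivSqZeroExt.snd_mul, TrivSqZeroExt.fst_add, TrivSqZeroExt.fst_inl, TrivSqZeroExt.fst_inr,
        TrivSqZeroExt.snd_inl, TrivSqZeroExt.snd_inr, smul_eq_mul, MulOpposite.smul_eq_mul_unop,
        MulOpposite.unop_op, add_zero, zero_add]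
      abel

/-- The extension of a derivation of `g` to a derivation of `U(g)`. -/
def envelopeDerivation (d : LieDerivation k g g) : Module.End k (U k g) :=
  (TrivSqZeroExt.sndHom (U k g) (U k g)).restrictScalars k ∘ₗ (lift k (dualNumberHom d)).toLinearMap

theorem envelopeDerivation_incl (d : LieDerivation k g g) (x : g) :
    envelopeDerivation d (incl k x) = incl k (d x) := by
  change (lift k (dualNumberHom d) (incl k x)).snd = _
  rw [lift_incl]
  simp [dualNumberHom]

theorem isLeibniz_envelopeDerivation (d : LieDerivation k g g) :
    IsLeibniz (envelopeDerivation d) := by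
  have fstHom_comp : (TrivSqZeroExt.fstHom k (U k g) (U k g)).comp (lift k (dualNumberHom d)) =
      AlgHom.id k (U k g) := by
    ext x
    change (lift k (dualNumberHom d) (incl k x)).fst = _
    rw [lift_incl]
    simp [dualNumberHom, incl]
  have hfst (E : U k g) : (lift k (dualNumberHom d) E).fst = E :=
    DFunLike.congr_fun fstHom_comp E
  intro E F
  change (lift k (dualNumberHom d) (E * F)).snd = (lift k (dualNumberHom d) E).snd * F +
    E * (lift k (dualNumberHom d) F).snd
  rw [map_mul, TrivSqZeroExt.snd_mul, hfst, hfst, smul_eq_mul, MulOpposite.smul_eq_mul_unop,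
    MulOpposite.unop_op, add_comm]

theorem coproduct_incl (x : g) : coproduct k g (incl k x) = incl k x ⊗ₜ 1 + 1 ⊗ₜ incl k x :=
  lift_incl (primitiveHom k g) x

end Enveloping

/-! ### The sub-adjacent Lie algebra -/

section SubAdjacent

variable (P : PostLieProduct k g)

/-- The sub-adjacent Lie algebra of a post-Lie algebra: a copy of `g` with the bracket
`x ▶ y - y ▶ x + ⁅x, y⁆`. -/
def SubAdjacent (_P : PostLieProduct k g) := g

namespace SubAdjacent

instance : AddCommGroup (SubAdjacent P) := inferInstanceAs (AddCommGroup g)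

instance : Module k (SubAdjacent P) := inferInstanceAs (Module k g)

/-- The identity map of `g`, regarded as a map from `g` to its sub-adjacent Lie algebra. -/
def of : g ≃ₗ[k] SubAdjacent P := LinearEquiv.refl k g

variable {P}

instance : Bracket (SubAdjacent P) (SubAdjacent P) where
  bracket x y := of P (P.op ((of P).symm x) ((of P).symm y) -
    P.op ((of P).symm y) ((of P).symm x) + ⁅(of P).symm x, (of P).symm y⁆)

theorem of_symm_lie (x y : SubAdjacent P) : (of P).symm ⁅x, y⁆ =
    P.op ((of P).symm x) ((of P).symm y) - P.op ((of P).symm y) ((of P).symm x) +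
      ⁅(of P).symm x, (of P).symm y⁆ := rfl

theorem of_lie_of (x y : g) :
    ⁅of P x, of P y⁆ = of P (P.op x y - P.op y x + ⁅x, y⁆) := rfl

instance : LieRing (SubAdjacent P) where
  add_lie x y z := (of P).symm.injective <| by
    simp only [of_symm_lie, map_add, LinearMap.add_apply, add_lie]
    abel
  lie_add x y z := (of P).symm.injective <| by
    simp only [of_symm_lie, map_add, LinearMap.add_apply, lie_add]
    abel
  lie_self x := (of P).symm.injective <| by
    simp only [of_symm_lie, lie_self, sub_self, add_zero, map_zero]
  leibniz_lie x y z := (of P).symm.injective <| by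
    simp only [of_symm_lie, map_add, map_sub, LinearMap.add_apply, LinearMap.sub_apply, P.lie_op,
      P.op_lie, lie_add, add_lie, lie_sub, sub_lie]
    rw [leibniz_lie ((of P).symm x) ((of P).symm y) ((of P).symm z),
      ← lie_skew ((of P).symm y) (P.op ((of P).symm z) ((of P).symm x))]
    abel

instance : LieAlgebra k (SubAdjacent P) where
  lie_smul c x y := (of P).symm.injective <| by
    simp only [of_symm_lie, map_smul, LinearMap.smul_apply, lie_smul, smul_add, smul_sub]

end SubAdjacent

open SubAdjacent

/-- The action of the sub-adjacent Lie algebra on `g` given by `x ↦ ad x + x ▶ ·`. -/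
def adAddOp : SubAdjacent P →ₗ⁅k⁆ Module.End k g where
  toFun x := ad k g ((of P).symm x) + P.op ((of P).symm x)
  map_add' x y := by
    rw [map_add, map_add, map_add]
    abel
  map_smul' c x := by simp only [map_smul, smul_add, RingHom.id_apply]
  map_lie' {x y} := by
    ext z
    simp only [of_symm_lie, LieRing.of_associative_ring_bracket, LinearMap.add_apply,
      LinearMap.sub_apply, Module.End.mul_apply, LieAlgebra.ad_apply, map_add, map_sub, P.lie_op,
      P.op_lie]
    rw [lie_lie]
    abel

theorem adAddOp_of (x y : g) : adAddOp P (of P x) y = ⁅x, y⁆ + P.op x y := rfl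

theorem adAddOp_lie (x : SubAdjacent P) (y z : g) :
    adAddOp P x ⁅y, z⁆ = ⁅adAddOp P x y, z⁆ + ⁅y, adAddOp P x z⁆ := by
  obtain ⟨x, rfl⟩ := (of P).surjective x
  simp only [adAddOp_of, P.op_lie, add_lie, lie_add, leibniz_lie x y z]
  abel

/-- The derivation `x ▶ ·` of `g`. -/
def opLieDerivation (x : g) : LieDerivation k g g where
  toLinearMap := P.op x
  leibniz' y z := by rw [P.op_lie, ← lie_skew z (P.op x y), sub_eq_add_neg, neg_neg, add_comm]

/-- The extension of `x ▶ ·` to a derivation of `U(g)`. -/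
def opDerivation (x : g) : Module.End k (U k g) := envelopeDerivation (opLieDerivation P x)

theorem opDerivation_incl (x y : g) : opDerivation P x (incl k y) = incl k (P.op x y) :=
  envelopeDerivation_incl _ y

theorem isLeibniz_opDerivation (x : g) : IsLeibniz (opDerivation P x) :=
  isLeibniz_envelopeDerivation _

theorem opDerivation_incl_mul (x y : g) (E : U k g) :
    opDerivation P x (incl k y * E) = incl k (P.op x y) * E + incl k y * opDerivation P x E := by
  rw [isLeibniz_opDerivation, opDerivation_incl]

theorem opDerivation_pow_incl (x y : g) (n : ℕ) :
    (opDerivation P x ^ n) (incl k y) = incl k ((P.op x ^ n) y) := by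
  induction n with
  | zero => rfl
  | succ n ih =>
    rw [pow_succ', Module.End.mul_apply, ih, opDerivation_incl, pow_succ', Module.End.mul_apply]

/-- The action of the sub-adjacent Lie algebra on `U(g)` by the derivations `x ▶ ·`. -/
def opDerivationHom : SubAdjacent P →ₗ⁅k⁆ Module.End k (U k g) where
  toFun x := opDerivation P ((of P).symm x)
  map_add' x y := (isLeibniz_opDerivation P _).ext_incl
    ((isLeibniz_opDerivation P _).add (isLeibniz_opDerivation P _)) fun z => by
      simp only [opDerivation_incl, map_add, LinearMap.add_apply, incl_add]
  map_smul' c x := (isLeibniz_opDerivation P _).ext_incl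
    ((isLeibniz_opDerivation P _).smul c) fun z => by
      simp only [opDerivation_incl, map_smul, LinearMap.smul_apply, incl_smul, RingHom.id_apply]
  map_lie' {x y} := (isLeibniz_opDerivation P _).ext_incl
    ((isLeibniz_opDerivation P _).lie (isLeibniz_opDerivation P _)) fun z => by
      simp only [opDerivation_incl, LieRing.of_associative_ring_bracket, LinearMap.sub_apply,
        Module.End.mul_apply, of_symm_lie, map_add, map_sub, LinearMap.add_apply, P.lie_op,
        incl_sub, incl_add]
      abel

theorem opDerivationHom_of (x : g) : opDerivationHom P (of P x) = opDerivation P x := rfl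

end SubAdjacent

/-! ### The Oudom–Guin isomorphism -/

section OudomGuin

open SubAdjacent

variable (P : PostLieProduct k g)

/-- The Grossman–Larson action `x ↦ (E ↦ x E + x ▶ E)` of the sub-adjacent Lie algebra on
`U(g)`. -/
def grossmanLarson : SubAdjacent P →ₗ⁅k⁆ Module.End k (U k g) where
  toFun x := mulLeft k (incl k ((of P).symm x)) + opDerivationHom P x
  map_add' x y := by
    ext E
    simp only [map_add, incl_add, LinearMap.add_apply, LinearMap.mulLeft_apply, add_mul]
    abel
  map_smul' c x := by
    ext E
    simp only [map_smul, incl_smul, LinearMap.add_apply, LinearMap.smul_apply,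
      LinearMap.mulLeft_apply, smul_mul_assoc, smul_add, RingHom.id_apply]
  map_lie' {x y} := by
    obtain ⟨x, rfl⟩ := (of P).surjective x
    obtain ⟨y, rfl⟩ := (of P).surjective y
    ext E
    simp only [LieHom.map_lie, opDerivationHom_of, LieRing.of_associative_ring_bracket,
      LinearMap.add_apply, LinearMap.sub_apply, LinearMap.mulLeft_apply, Module.End.mul_apply,
      opDerivation_incl_mul, of_symm_lie, LinearEquiv.symm_apply_apply, incl_add,
      incl_sub, incl_lie, add_mul, sub_mul, mul_add, mul_assoc]
    abel

theorem grossmanLarson_of (x : g) (E : U k g) :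
    grossmanLarson P (of P x) E = incl k x * E + opDerivation P x E := rfl

theorem grossmanLarson_incl_mul (x : SubAdjacent P) (y : g) (E : U k g) :
    grossmanLarson P x (incl k y * E) =
      incl k (adAddOp P x y) * E + incl k y * grossmanLarson P x E := by
  obtain ⟨x, rfl⟩ := (of P).surjective x
  simp only [grossmanLarson_of, opDerivation_incl_mul, adAddOp_of, incl_add, incl_lie, mul_add,
    add_mul, sub_mul, mul_assoc]
  abel

/-- The map `U(SubAdjacent P) → U(g)` that carries left multiplication by elements of the
sub-adjacent Lie algebra to the Grossman–Larson action. -/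
def toEnvelope : U k (SubAdjacent P) →ₗ[k] U k g :=
  LinearMap.applyₗ 1 ∘ₗ (lift k (grossmanLarson P)).toLinearMap

theorem toEnvelope_one : toEnvelope P 1 = 1 :=
  LinearMap.congr_fun (map_one (lift k (grossmanLarson P))) 1

theorem toEnvelope_incl_mul (x : SubAdjacent P) (w : U k (SubAdjacent P)) :
    toEnvelope P (incl k x * w) = grossmanLarson P x (toEnvelope P w) :=
  lift_incl_mul_apply _ x w 1

/-- The action of the sub-adjacent Lie algebra on the linear maps `n : g → U(SubAdjacent P)` given
by `(x • n) z = x (n z) - n ([x, z] + x ▶ z)`. -/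
def homAction : SubAdjacent P →ₗ⁅k⁆ Module.End k (g →ₗ[k] U k (SubAdjacent P)) where
  toFun x := LinearMap.llcomp k g _ _ (mulLeft k (incl k x)) - LinearMap.lcomp k _ (adAddOp P x)
  map_add' x y := by
    ext n z
    simp only [map_add, incl_add, LinearMap.add_apply, LinearMap.sub_apply,
      LinearMap.llcomp_apply, LinearMap.lcomp_apply, LinearMap.mulLeft_apply, add_mul]
    abel
  map_smul' c x := by
    ext n z
    simp only [map_smul, incl_smul, LinearMap.sub_apply, LinearMap.smul_apply,
      LinearMap.llcomp_apply, LinearMap.lcomp_apply, LinearMap.mulLeft_apply, smul_mul_assoc,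
      smul_sub, RingHom.id_apply]
  map_lie' {x y} := by
    ext n z
    simp only [LieHom.map_lie, incl_lie, LieRing.of_associative_ring_bracket, LinearMap.sub_apply,
      LinearMap.llcomp_apply, LinearMap.lcomp_apply, LinearMap.mulLeft_apply, Module.End.mul_apply,
      map_sub, sub_mul, mul_sub, mul_assoc]
    abel

theorem homAction_apply (x : SubAdjacent P) (n : g →ₗ[k] U k (SubAdjacent P)) (z : g) :
    homAction P x n z = incl k x * n z - n (adAddOp P x z) := rfl

/-- Multiplication by `x ∈ g` on `U(g)`, transported to `U(SubAdjacent P)`; as a function of `x` it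
is obtained by acting on `x ↦ x` through `homAction`. -/
def transportedMul : g →ₗ[k] Module.End k (U k (SubAdjacent P)) :=
  ((LinearMap.applyₗ ((ι k).toLinearMap ∘ₗ (of P).toLinearMap)) ∘ₗ
    (lift k (homAction P)).toLinearMap).flip

theorem transportedMul_one (x : g) : transportedMul P x 1 = incl k (of P x) := by
  change lift k (homAction P) 1 _ x = _
  rw [map_one]
  rfl

theorem transportedMul_incl_mul (x : g) (y : SubAdjacent P) (w : U k (SubAdjacent P)) :
    transportedMul P x (incl k y * w) =
      incl k y * transportedMul P x w - transportedMul P (adAddOp P y x) w := by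
  change lift k (homAction P) (incl k y * w) _ x = _
  rw [lift_incl_mul_apply, homAction_apply]
  rfl

theorem transportedMul_incl (x : g) (y : SubAdjacent P) : transportedMul P x (incl k y) =
    incl k y * incl k (of P x) - incl k (of P (adAddOp P y x)) := by
  rw [← mul_one (incl k y), transportedMul_incl_mul, transportedMul_one, transportedMul_one,
    mul_one]

theorem transportedMul_lie (x y : g) :
    transportedMul P ⁅x, y⁆ = ⁅transportedMul P x, transportedMul P y⁆ := by
  let K : Submodule k (U k (SubAdjacent P)) := ⨅ x : g, ⨅ y : g,
    LinearMap.eqLocus (transportedMul P ⁅x, y⁆) ⁅transportedMul P x, transportedMul P y⁆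
  have mem_K (w) : w ∈ K ↔ ∀ x y : g, transportedMul P ⁅x, y⁆ w =
      transportedMul P x (transportedMul P y w) - transportedMul P y (transportedMul P x w) := by
    simp only [K, Submodule.mem_iInf, LinearMap.mem_eqLocus, LieRing.of_associative_ring_bracket,
      LinearMap.sub_apply, Module.End.mul_apply]
  ext w
  suffices w ∈ K from (mem_K w).1 this x y
  refine envelope_induction ((mem_K 1).2 fun x y => ?_)
    (fun z w hw => (mem_K _).2 fun x y => ?_) w
  · have hxy := (incl_lie (k := k) (of P x) (of P y)).symm
    rw [of_lie_of, sub_eq_iff_eq_add] at hxy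
    rw [transportedMul_one, transportedMul_one, transportedMul_one, transportedMul_incl,
      transportedMul_incl, adAddOp_of, adAddOp_of, ← lie_skew y x, neg_add_eq_sub, hxy]
    simp only [map_add, map_sub, incl_add, incl_sub]
    abel
  · rw [mem_K] at hw
    simp only [transportedMul_incl_mul, map_sub, hw, adAddOp_lie, map_add, LinearMap.add_apply,
      mul_sub]
    abel

/-- `transportedMul` as a representation of `g`. -/
def transportedMulHom : g →ₗ⁅k⁆ Module.End k (U k (SubAdjacent P)) where
  __ := transportedMul P
  map_lie' {x y} := transportedMul_lie P x y

/-- The inverse of `toEnvelope`. -/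
def ofEnvelope : U k g →ₗ[k] U k (SubAdjacent P) :=
  LinearMap.applyₗ 1 ∘ₗ (lift k (transportedMulHom P)).toLinearMap

theorem ofEnvelope_one : ofEnvelope P 1 = 1 :=
  LinearMap.congr_fun (map_one (lift k (transportedMulHom P))) 1

theorem ofEnvelope_incl_mul (x : g) (E : U k g) :
    ofEnvelope P (incl k x * E) = transportedMul P x (ofEnvelope P E) :=
  lift_incl_mul_apply (transportedMulHom P) x E 1

theorem toEnvelope_transportedMul (x : g) (w : U k (SubAdjacent P)) :
    toEnvelope P (transportedMul P x w) = incl k x * toEnvelope P w := by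
  let K : Submodule k (U k (SubAdjacent P)) := ⨅ x : g, LinearMap.eqLocus
    (toEnvelope P ∘ₗ transportedMul P x) (mulLeft k (incl k x) ∘ₗ toEnvelope P)
  have mem_K (w) : w ∈ K ↔ ∀ x : g,
      toEnvelope P (transportedMul P x w) = incl k x * toEnvelope P w := by
    simp only [K, Submodule.mem_iInf, LinearMap.mem_eqLocus, LinearMap.comp_apply,
      LinearMap.mulLeft_apply]
  suffices w ∈ K from (mem_K w).1 this x
  refine envelope_induction ((mem_K 1).2 fun x => ?_) (fun y w hw => (mem_K _).2 fun x => ?_) w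
  · rw [transportedMul_one, ← mul_one (incl k (of P x)), toEnvelope_incl_mul, toEnvelope_one,
      grossmanLarson_of, (isLeibniz_opDerivation P x).map_one, add_zero]
  · rw [mem_K] at hw
    rw [transportedMul_incl_mul, map_sub, toEnvelope_incl_mul, hw, hw, toEnvelope_incl_mul,
      grossmanLarson_incl_mul, add_sub_cancel_left]

theorem ofEnvelope_opDerivation (x : g) (E : U k g) : ofEnvelope P (opDerivation P x E) =
    incl k (of P x) * ofEnvelope P E - transportedMul P x (ofEnvelope P E) := by
  refine envelope_induction (K := LinearMap.eqLocus (ofEnvelope P ∘ₗ opDerivation P x)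
    ((mulLeft k (incl k (of P x)) - transportedMul P x) ∘ₗ ofEnvelope P)) ?_ (fun y E hE => ?_) E
  · rw [LinearMap.mem_eqLocus, LinearMap.comp_apply, LinearMap.comp_apply,
      (isLeibniz_opDerivation P x).map_one, map_zero, ofEnvelope_one, LinearMap.sub_apply,
      transportedMul_one, LinearMap.mulLeft_apply, mul_one, sub_self]
  · rw [LinearMap.mem_eqLocus, LinearMap.comp_apply, LinearMap.comp_apply, LinearMap.sub_apply,
      LinearMap.mulLeft_apply] at hE ⊢
    rw [opDerivation_incl_mul, map_add, ofEnvelope_incl_mul, ofEnvelope_incl_mul,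
      ofEnvelope_incl_mul, hE, map_sub, transportedMul_incl_mul, adAddOp_of, map_add,
      transportedMul_lie, LieRing.of_associative_ring_bracket, LinearMap.add_apply,
      LinearMap.sub_apply, Module.End.mul_apply, Module.End.mul_apply]
    abel

theorem ofEnvelope_grossmanLarson (x : SubAdjacent P) (E : U k g) :
    ofEnvelope P (grossmanLarson P x E) = incl k x * ofEnvelope P E := by
  obtain ⟨x, rfl⟩ := (of P).surjective x
  rw [grossmanLarson_of, map_add, ofEnvelope_incl_mul, ofEnvelope_opDerivation,
    add_sub_cancel]

/-- The Oudom–Guin isomorphism: `U(g)` with the Grossman–Larson product is the enveloping algebra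
of the sub-adjacent Lie algebra. -/
def oudomGuinEquiv : U k (SubAdjacent P) ≃ₗ[k] U k g where
  __ := toEnvelope P
  invFun := ofEnvelope P
  left_inv w := by
    refine envelope_induction (K := LinearMap.eqLocus (ofEnvelope P ∘ₗ toEnvelope P) .id) ?_
      (fun x w hw => ?_) w
    · rw [LinearMap.mem_eqLocus, LinearMap.comp_apply, toEnvelope_one, ofEnvelope_one,
        LinearMap.id_apply]
    · rw [LinearMap.mem_eqLocus, LinearMap.comp_apply, LinearMap.id_apply] at hw ⊢
      rw [toEnvelope_incl_mul, ofEnvelope_grossmanLarson, hw]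
  right_inv E := by
    refine envelope_induction (K := LinearMap.eqLocus (toEnvelope P ∘ₗ ofEnvelope P) .id) ?_
      (fun x E hE => ?_) E
    · rw [LinearMap.mem_eqLocus, LinearMap.comp_apply, ofEnvelope_one, toEnvelope_one,
        LinearMap.id_apply]
    · rw [LinearMap.mem_eqLocus, LinearMap.comp_apply, LinearMap.id_apply] at hE ⊢
      rw [ofEnvelope_incl_mul, toEnvelope_transportedMul, hE]

variable {P} in
theorem grossmanLarson_induction {K : Submodule k (U k g)} (one : 1 ∈ K)
    (mem : ∀ x : g, ∀ E ∈ K, incl k x * E + opDerivation P x E ∈ K) (E : U k g) : E ∈ K := by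
  obtain ⟨w, rfl⟩ := (oudomGuinEquiv P).surjective E
  refine envelope_induction (K := K.comap (toEnvelope P)) ?_ (fun x w hw => ?_) w
  · rwa [Submodule.mem_comap, toEnvelope_one]
  · rw [Submodule.mem_comap, toEnvelope_incl_mul]
    exact mem ((of P).symm x) _ hw

end OudomGuin

/-! ### The extension of the post-Lie product to `U(g)` -/

theorem IsLeibniz.rTensor_add_lTensor {k A : Type*} [CommRing k] [Ring A] [Algebra k A]
    {d : Module.End k A} (hd : IsLeibniz d) : IsLeibniz (d.rTensor A + d.lTensor A) := by
  intro z w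
  induction z using TensorProduct.induction_on with
  | zero => simp only [zero_mul, map_zero, add_zero]
  | add z z' hz hz' =>
    rw [add_mul, map_add, hz, hz', map_add, add_mul, add_mul]
    abel
  | tmul a b =>
    induction w using TensorProduct.induction_on with
    | zero => simp only [mul_zero, map_zero, add_zero]
    | add w w' hw hw' =>
      rw [mul_add, map_add, hw, hw', map_add, mul_add, mul_add]
      abel
    | tmul a' b' =>
      simp only [Algebra.TensorProduct.tmul_mul_tmul, LinearMap.add_apply, LinearMap.rTensor_tmul,
        LinearMap.lTensor_tmul, hd _ _, TensorProduct.add_tmul, TensorProduct.tmul_add, add_mul,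
        mul_add]
      abel

theorem coproduct_envelopeDerivation (d : LieDerivation k g g) (E : U k g) :
    coproduct k g (envelopeDerivation d E) =
      ((envelopeDerivation d).rTensor (U k g) + (envelopeDerivation d).lTensor (U k g))
        (coproduct k g E) := by
  set D := envelopeDerivation d
  have hD : IsLeibniz D := isLeibniz_envelopeDerivation d
  set D₂ := D.rTensor (U k g) + D.lTensor (U k g)
  have hD₂ : IsLeibniz D₂ := hD.rTensor_add_lTensor
  have hincl (x : g) : coproduct k g (D (incl k x)) = D₂ (coproduct k g (incl k x)) := by
    simp only [D₂, D, envelopeDerivation_incl, coproduct_incl, map_add, LinearMap.add_apply,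
      LinearMap.rTensor_tmul, LinearMap.lTensor_tmul, hD.map_one, TensorProduct.zero_tmul,
      TensorProduct.tmul_zero, add_zero, zero_add]
  refine envelope_induction (K := LinearMap.eqLocus
    ((coproduct k g).toLinearMap ∘ₗ D) (D₂ ∘ₗ (coproduct k g).toLinearMap)) ?_
    (fun x E hE => ?_) E
  · simp only [LinearMap.mem_eqLocus, LinearMap.comp_apply, AlgHom.toLinearMap_apply, map_one,
      hD.map_one, hD₂.map_one, map_zero]
  · simp only [LinearMap.mem_eqLocus, LinearMap.comp_apply, AlgHom.toLinearMap_apply] at hE ⊢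
    rw [hD, map_add, map_mul, map_mul, map_mul, hD₂, hE, hincl]

section Extension

open SubAdjacent

variable (P : PostLieProduct k g)

/-- The extension of a post-Lie product to `U(g)`: the action of `U(SubAdjacent P)` on `U(g)` by
derivations, transported along the Oudom–Guin isomorphism. -/
def extension : U k g →ₗ[k] Module.End k (U k g) :=
  (lift k (opDerivationHom P)).toLinearMap ∘ₗ (oudomGuinEquiv P).symm.toLinearMap

theorem extension_one : extension P 1 = 1 := by
  change lift k (opDerivationHom P) (ofEnvelope P 1) = 1
  rw [ofEnvelope_one, map_one]

theorem extension_incl_mul_add (x : g) (E : U k g) :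
    extension P (incl k x * E + opDerivation P x E) = opDerivation P x * extension P E := by
  change lift k (opDerivationHom P) (ofEnvelope P (grossmanLarson P (of P x) E)) = _
  rw [ofEnvelope_grossmanLarson, map_mul, lift_incl, opDerivationHom_of]
  rfl

theorem extension_incl (x : g) : extension P (incl k x) = opDerivation P x := by
  simpa only [mul_one, (isLeibniz_opDerivation P x).map_one, add_zero, extension_one] using
    extension_incl_mul_add P x 1

/-- The product `(E₍₁₎ ▶ F₁) (E₍₂₎ ▶ F₂)`, in Sweedler notation, as a function of `E₍₁₎ ⊗ E₍₂₎`. -/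
def sweedlerProduct (T : U k g →ₗ[k] Module.End k (U k g)) (F₁ F₂ : U k g) :
    U k g ⊗[k] U k g →ₗ[k] U k g :=
  LinearMap.mul' k (U k g) ∘ₗ TensorProduct.map (T.flip F₁) (T.flip F₂)

theorem sweedlerProduct_extension (x : g) (F₁ F₂ : U k g) (z : U k g ⊗[k] U k g) :
    sweedlerProduct (extension P) F₁ F₂ (coproduct k g (incl k x) * z +
      ((opDerivation P x).rTensor (U k g) + (opDerivation P x).lTensor (U k g)) z) =
      opDerivation P x (sweedlerProduct (extension P) F₁ F₂ z) := by
  have apply_incl_mul_add (E F : U k g) :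
      extension P (incl k x * E) F + extension P (opDerivation P x E) F =
        opDerivation P x (extension P E F) := by
    rw [← LinearMap.add_apply, ← map_add, extension_incl_mul_add, Module.End.mul_apply]
  induction z using TensorProduct.induction_on with
  | zero => simp only [mul_zero, map_zero, add_zero]
  | add z z' hz hz' =>
    rw [mul_add, map_add _ z z', add_add_add_comm, map_add, hz, hz', ← map_add, ← map_add]
  | tmul E E' =>
    simp only [sweedlerProduct, coproduct_incl, add_mul, Algebra.TensorProduct.tmul_mul_tmul,
      one_mul, LinearMap.add_apply, LinearMap.rTensor_tmul, LinearMap.lTensor_tmul, map_add,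
      LinearMap.comp_apply, TensorProduct.map_tmul, LinearMap.mul'_apply, LinearMap.flip_apply,
      isLeibniz_opDerivation P x _ _, ← apply_incl_mul_add, mul_add]
    abel

theorem extension_mul (E F₁ F₂ : U k g) : extension P E (F₁ * F₂) =
    sweedlerProduct (extension P) F₁ F₂ (coproduct k g E) := by
  refine grossmanLarson_induction (P := P) (K := LinearMap.eqLocus ((extension P).flip (F₁ * F₂))
    (sweedlerProduct (extension P) F₁ F₂ ∘ₗ (coproduct k g).toLinearMap)) ?_ (fun x E hE => ?_) E
  · simp only [LinearMap.mem_eqLocus, LinearMap.flip_apply, extension_one, Module.End.one_apply,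
      LinearMap.comp_apply, AlgHom.toLinearMap_apply, map_one, Algebra.TensorProduct.one_def,
      sweedlerProduct, TensorProduct.map_tmul, LinearMap.mul'_apply]
  · simp only [LinearMap.mem_eqLocus, LinearMap.flip_apply, LinearMap.comp_apply,
      AlgHom.toLinearMap_apply] at hE ⊢
    rw [extension_incl_mul_add, Module.End.mul_apply, hE, map_add, map_mul, opDerivation,
      coproduct_envelopeDerivation, ← opDerivation, sweedlerProduct_extension]

theorem isEnvelopeExtension_extension : IsEnvelopeExtension P (extension P) where
  incl_incl x y := by rw [extension_incl, opDerivation_incl]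
  one_left F := by rw [extension_one, Module.End.one_apply]
  incl_mul x E F := by
    rw [eq_sub_iff_add_eq, extension_incl, ← LinearMap.add_apply, ← map_add,
      extension_incl_mul_add, Module.End.mul_apply]
  right_mul := extension_mul P

end Extension

namespace IsEnvelopeExtension

variable {P : PostLieProduct k g} {T T' : U k g →ₗ[k] U k g →ₗ[k] U k g}

theorem one (hT : IsEnvelopeExtension P T) : T 1 = .id := LinearMap.ext hT.one_left

theorem incl_left (hT : IsEnvelopeExtension P T) (x : g) : T (incl k x) = opDerivation P x := by
  refine IsLeibniz.ext_incl (fun E F => ?_) (isLeibniz_opDerivation P x) fun y => ?_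
  · simp only [hT.right_mul, coproduct_incl, map_add, TensorProduct.map_tmul, LinearMap.mul'_apply,
      LinearMap.flip_apply, hT.one_left]
  · rw [hT.incl_incl, opDerivation_incl]

theorem incl_mul_add (hT : IsEnvelopeExtension P T) (x : g) (E : U k g) :
    T (incl k x * E + opDerivation P x E) = opDerivation P x ∘ₗ T E := by
  ext F
  rw [map_add, LinearMap.add_apply, hT.incl_mul, hT.incl_left, sub_add_cancel,
    LinearMap.comp_apply]

theorem eq (hT : IsEnvelopeExtension P T) (hT' : IsEnvelopeExtension P T') : T = T' := by
  ext1 E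
  refine grossmanLarson_induction (P := P) (K := LinearMap.eqLocus T T') ?_ (fun x E hE => ?_) E
  · rw [LinearMap.mem_eqLocus, hT.one, hT'.one]
  · rw [LinearMap.mem_eqLocus] at hE ⊢
    rw [hT.incl_mul_add, hT'.incl_mul_add, hE]

theorem mulLeft_add_opDerivation_pow_one (hT : IsEnvelopeExtension P T) (x : g) (n : ℕ) :
    T (((mulLeft k (incl k x) + opDerivation P x) ^ n) 1) = opDerivation P x ^ n := by
  induction n with
  | zero => exact hT.one
  | succ n ih =>
    rw [pow_succ', Module.End.mul_apply, LinearMap.add_apply, LinearMap.mulLeft_apply,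
      hT.incl_mul_add, ih, pow_succ', Module.End.mul_eq_comp]

end IsEnvelopeExtension

/-! ### The restricted enveloping algebra -/

theorem mem_of_mem_span_of_commute {A : Type*} [Ring A] {s : Set A} {S : Type*} [SetLike S A]
    [AddSubgroupClass S A] {K : S} (commute : ∀ c ∈ s, ∀ a, Commute c a)
    (mul_mem : ∀ c ∈ s, ∀ a, a * c ∈ K) {z : A} (hz : z ∈ TwoSidedIdeal.span s) : z ∈ K := by
  rw [TwoSidedIdeal.mem_span_iff_mem_addSubgroup_closure] at hz
  refine (AddSubgroup.closure_le (AddSubgroup.ofClass K)).2 ?_ hz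
  rintro _ ⟨_, ⟨a, -, c, hc, rfl⟩, b, -, rfl⟩
  change a * c * b ∈ K
  rw [mul_assoc, commute c hc b, ← mul_assoc]
  exact mul_mem c hc (a * b)

theorem mem_ker_proj {p : ℕ} {R : PMap k g p} {E : U k g} :
    E ∈ (proj R).toLinearMap.ker ↔ E ∈ restrictedIdeal R := by
  rw [LinearMap.mem_ker, TwoSidedIdeal.mem_iff, ← map_zero (proj R)]
  exact RingCon.eq _

theorem existsUnique_bilinear_descent {k M N : Type*} [CommRing k] [AddCommGroup M] [Module k M]
    [AddCommGroup N] [Module k N] {π : M →ₗ[k] N} (hπ : Function.Surjective π)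
    {T : M →ₗ[k] M →ₗ[k] M} (hl : ∀ x ∈ π.ker, ∀ y, T x y ∈ π.ker)
    (hr : ∀ y ∈ π.ker, ∀ x, T x y ∈ π.ker) :
    ∃! S : N →ₗ[k] N →ₗ[k] N, ∀ x y, S (π x) (π y) = π (T x y) := by
  let f (u v : N) : N := π (T (Function.surjInv hπ u) (Function.surjInv hπ v))
  have f_map (x y : M) : f (π x) (π y) = π (T x y) := by
    have sub_mem (z : M) : Function.surjInv hπ (π z) - z ∈ π.ker :=
      LinearMap.sub_mem_ker_iff.2 (Function.surjInv_eq hπ _)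
    have hx := hl _ (sub_mem x) (Function.surjInv hπ (π y))
    have hy := hr _ (sub_mem y) x
    rw [map_sub, LinearMap.sub_apply, LinearMap.sub_mem_ker_iff] at hx
    rw [map_sub, LinearMap.sub_mem_ker_iff] at hy
    exact hx.trans hy
  refine ⟨LinearMap.mk₂ k f ?_ ?_ ?_ ?_, f_map, fun S hS => LinearMap.ext₂ fun u v => ?_⟩
  · refine hπ.forall.2 fun x => hπ.forall.2 fun x' => hπ.forall.2 fun y => ?_
    rw [← map_add, f_map, f_map, f_map, map_add, LinearMap.add_apply, map_add]
  · refine fun c => hπ.forall.2 fun x => hπ.forall.2 fun y => ?_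
    rw [← map_smul, f_map, f_map, map_smul, LinearMap.smul_apply, map_smul]
  · refine hπ.forall.2 fun x => hπ.forall.2 fun y => hπ.forall.2 fun y' => ?_
    rw [← map_add, f_map, f_map, f_map, map_add, map_add]
  · refine fun c => hπ.forall.2 fun x => hπ.forall.2 fun y => ?_
    rw [← map_smul, f_map, f_map, map_smul, map_smul]
  · obtain ⟨x, rfl⟩ := hπ u
    obtain ⟨y, rfl⟩ := hπ v
    exact (hS x y).trans (f_map x y).symm

section Restricted

variable {p : ℕ} [Fact p.Prime] [CharP k p] (R : PMap k g p) (P : PostLieProduct k g)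

theorem commute_pow_char_sub_pMap (x : g) (E : U k g) :
    Commute (incl k x ^ p - incl k (R.toFun x)) E := by
  refine commute_of_commute_incl (fun y => ?_) E
  have had : ⁅incl k x ^ p, incl k y⁆ = ⁅incl k (R.toFun x), incl k y⁆ := calc
    _ = (ad k (U k g) (incl k x) ^ p) (incl k y) := by rw [ad_pow_char, LieAlgebra.ad_apply]
    _ = incl k ((ad k g x ^ p) y) := (map_ad_pow (ι k) x y p).symm
    _ = _ := by rw [← R.ad_map, LieAlgebra.ad_apply]; exact LieHom.map_lie (ι k) _ _
  rw [commute_iff_lie_eq, sub_lie, had, sub_self]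

variable {R P}

theorem opDerivation_pow_char_sub_pMap (hP : TriviallyRestricted R P) (x y : g) :
    opDerivation P y (incl k x ^ p - incl k (R.toFun x)) = 0 := by
  rw [map_sub, (isLeibniz_opDerivation P y).map_pow_char p, opDerivation_incl, opDerivation_incl,
    hP.op_pMap, sub_eq_zero]
  exact (map_ad_pow (ι k) x (P.op y x) (p - 1)).symm

theorem opDerivation_pow_char (hP : TriviallyRestricted R P) (x : g) :
    opDerivation P x ^ p = opDerivation P (subadjacentPMap R P x) :=
  ((isLeibniz_opDerivation P x).pow_char p).ext_incl (isLeibniz_opDerivation P _) fun y => by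
    rw [opDerivation_pow_incl, opDerivation_incl, hP.subadjacent_op]

theorem mulLeft_add_opDerivation_pow_char_one (R : PMap k g p) (P : PostLieProduct k g) (x : g) :
    ((mulLeft k (incl k x) + opDerivation P x) ^ p) 1 =
      incl k x ^ p + incl k (subadjacentPMap R P x - R.toFun x) := by
  let L : g →ₗ⁅k⁆ Module.End k (U k g) := (Algebra.lmul k (U k g)).toLieHom.comp (ι k)
  have ad_pow (l : ℕ) : (ad k _ (opDerivation P x) ^ (l - 1)) (mulLeft k (incl k x)) =
      L (P.bullet x l) := by
    rw [(isLeibniz_opDerivation P x).ad_pow_mulLeft, opDerivation_pow_incl]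
    rfl
  have pow_one : (opDerivation P x ^ p) 1 = 0 := ((isLeibniz_opDerivation P x).pow_char p).map_one
  have L_one (y : g) : L y 1 = incl k y := mul_one _
  rw [add_pow_char_eq_sum_composition (k := k), LinearMap.add_apply, LinearMap.add_apply, pow_one,
    add_zero, LinearMap.pow_mulLeft, LinearMap.mulLeft_apply, mul_one, subadjacentPMap,
    add_sub_cancel_left]
  refine congrArg (incl k x ^ p + ·)
    ((DFunLike.congr_fun (F := Module.End k (U k g)) ?_ 1).trans (L_one _))
  simp only [map_sum, map_smul, map_nestedBracket, List.map_map, ad_pow]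
  refine Finset.sum_congr rfl fun n _ => congrArg _ (Finset.sum_congr rfl fun c hc => ?_)
  rw [bracketCoeff, c.blocks_length, (Finset.mem_filter.1 hc).2]
  rfl

theorem mem_of_mem_restrictedIdeal {K : Submodule k (U k g)}
    (mul_mem : ∀ (x : g) (E : U k g), E * (incl k x ^ p - incl k (R.toFun x)) ∈ K) {E : U k g}
    (hE : E ∈ restrictedIdeal R) : E ∈ K := by
  refine mem_of_mem_span_of_commute ?_ ?_ hE
  · rintro _ ⟨x, rfl⟩
    exact commute_pow_char_sub_pMap R x
  · rintro _ ⟨x, rfl⟩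
    exact mul_mem x

theorem opDerivation_mem_ker_proj (hP : TriviallyRestricted R P) (y : g) {E : U k g}
    (hE : E ∈ (proj R).toLinearMap.ker) : opDerivation P y E ∈ (proj R).toLinearMap.ker := by
  rw [mem_ker_proj] at hE
  refine mem_of_mem_restrictedIdeal (K := (proj R).toLinearMap.ker.comap (opDerivation P y))
    (fun x E => ?_) hE
  rw [Submodule.mem_comap, isLeibniz_opDerivation, opDerivation_pow_char_sub_pMap hP, mul_zero,
    add_zero, mem_ker_proj]
  exact (restrictedIdeal R).mul_mem_left _ _ (TwoSidedIdeal.subset_span ⟨x, rfl⟩)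

namespace IsEnvelopeExtension

variable {T : U k g →ₗ[k] U k g →ₗ[k] U k g}

theorem pow_char_sub_pMap (hT : IsEnvelopeExtension P T) (hP : TriviallyRestricted R P) (x : g) :
    T (incl k x ^ p - incl k (R.toFun x)) = 0 := by
  have h := hT.mulLeft_add_opDerivation_pow_one x p
  rw [mulLeft_add_opDerivation_pow_char_one R P, incl_sub, opDerivation_pow_char hP,
    ← hT.incl_left, add_sub_left_comm, map_add, add_eq_left] at h
  exact h

theorem eq_zero_of_mem_restrictedIdeal (hT : IsEnvelopeExtension P T)
    (hP : TriviallyRestricted R P) {E : U k g} (hE : E ∈ restrictedIdeal R) : T E = 0 := by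
  refine mem_of_mem_restrictedIdeal (K := LinearMap.ker T) (fun x E => ?_) hE
  refine grossmanLarson_induction (P := P) (K := (LinearMap.ker T).comap
    (mulRight k (incl k x ^ p - incl k (R.toFun x)))) ?_ (fun y E hE => ?_) E
  · rw [Submodule.mem_comap, LinearMap.mulRight_apply, one_mul, LinearMap.mem_ker,
      hT.pow_char_sub_pMap hP]
  · rw [Submodule.mem_comap, LinearMap.mulRight_apply, LinearMap.mem_ker] at hE ⊢
    have hDE : opDerivation P y (E * (incl k x ^ p - incl k (R.toFun x))) =
        opDerivation P y E * (incl k x ^ p - incl k (R.toFun x)) := by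
      rw [isLeibniz_opDerivation, opDerivation_pow_char_sub_pMap hP, mul_zero, add_zero]
    rw [add_mul, mul_assoc, ← hDE, hT.incl_mul_add, hE, LinearMap.comp_zero]

theorem apply_mem_restrictedIdeal (hT : IsEnvelopeExtension P T) (hP : TriviallyRestricted R P)
    {E : U k g} (hE : E ∈ restrictedIdeal R) (F : U k g) : T F E ∈ restrictedIdeal R := by
  rw [← mem_ker_proj] at hE ⊢
  refine grossmanLarson_induction (P := P) (K := (proj R).toLinearMap.ker.comap (T.flip E)) ?_
    (fun x F hF => ?_) F
  · rwa [Submodule.mem_comap, LinearMap.flip_apply, hT.one_left]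
  · rw [Submodule.mem_comap, LinearMap.flip_apply] at hF ⊢
    rw [hT.incl_mul_add]
    exact opDerivation_mem_ker_proj hP x hF

end IsEnvelopeExtension

end Restricted

end RestrictedPostLie

end

open RestrictedPostLie in
theorem mainTheorem5 {k : Type*} {g : Type*} [Field k] [LieRing g] [LieAlgebra k g]
    (p : ℕ) [Fact p.Prime] [CharP k p]
    (R : PMap k g p) (P : PostLieProduct k g) (hP : TriviallyRestricted R P) :
    ∃ T : U k g →ₗ[k] U k g →ₗ[k] U k g,
      IsEnvelopeExtension P T ∧
      (∀ T' : U k g →ₗ[k] U k g →ₗ[k] U k g, IsEnvelopeExtension P T' → T' = T) ∧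
      (∀ E ∈ restrictedIdeal R, ∀ F : U k g,
        T E F ∈ restrictedIdeal R ∧ T F E ∈ restrictedIdeal R) ∧
      ∃! S : RestrictedEnvelope R →ₗ[k] RestrictedEnvelope R →ₗ[k] RestrictedEnvelope R,
        ∀ E F : U k g, S (proj R E) (proj R F) = proj R (T E F) := by
  have hT := isEnvelopeExtension_extension P
  have mem_left : ∀ E ∈ restrictedIdeal R, ∀ F, extension P E F ∈ restrictedIdeal R :=
    fun E hE F => by
      rw [hT.eq_zero_of_mem_restrictedIdeal hP hE, LinearMap.zero_apply]
      exact (restrictedIdeal R).zero_mem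
  have mem_right : ∀ E ∈ restrictedIdeal R, ∀ F, extension P F E ∈ restrictedIdeal R :=
    fun E hE F => hT.apply_mem_restrictedIdeal hP hE F
  refine ⟨extension P, hT, fun T' hT' => hT'.eq hT,
    fun E hE F => ⟨mem_left E hE F, mem_right E hE F⟩, ?_⟩
  simp only [← mem_ker_proj] at mem_left mem_right
  exact existsUnique_bilinear_descent (π := (proj R).toLinearMap)
    (RingCon.mk'_surjective (restrictedIdeal R).ringCon) mem_left mem_right
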